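/- Let $\gamma\in\mathbb R$, $\mathbb E_\gamma=\{y\in\mathbb R: 1+\gamma y>0\}$, and read $(1+\gamma y)^{1/\gamma}$ as $e^{y}$ when $\gamma=0$. Let $Y$ be a real random variable whose distribution is in the domain of attraction of the extreme value distribution $G_\gamma$ with normalizing functions $a(t)>0$, $b(t)\in\mathbb R$ ($t>0$), i.e. $$t\,\mathbb P[Y>a(t)y+b(t)]\to(1+\gamma y)^{-1/\gamma}\quad (t\to\infty),\qquad y\in\mathbb E_\gamma .$$ Let $b^*:(0,\infty)\to\mathbb R$ be continuous and strictly increasing with $(b^*(t)-b(t))/a(t)\to0$ as $t\to\infty$. Let $K$ be a transition function from $\mathbb R$ to $[-\infty,\infty]$ (each $K(y,\cdot)$ is a Borel probability measure on $[-\infty,\infty]$, and $y\mapsto K(y,A)$ is measurable for each Borel $A$), and put $K^*(y,\cdot)=K(b^*(y),\cdot)$ for $y>0$. Let $\alpha(t)>0$ and $\beta(t)\in\mathbb R$ be functions on $(0,\infty)$. Below, $\Rightarrow$ denotes weak convergence on $[-\infty,\infty]$, as $t\to\infty$, of the probability measures with the indicated distribution functions of $x$. There is a transition function $\phi^*$ from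 $(0,\infty)$ to $[-\infty,\infty]$ such that $$K^*\big(tu_t,[-\infty,\alpha(t)x+\beta(t)]\big)\Rightarrow\phi^*(u,[-\infty,x])\quad\text{whenever }u_t\to u\in(0,\infty)\qquad(1)$$ if and only if there is a transition function $\phi$ from $\mathbb E_\gamma$ to $[-\infty,\infty]$ such that $$K\big(a(t)u_t+b(t),[-\infty,\alpha(t)x+\beta(t)]\big)\Rightarrow\phi(u,[-\infty,x])\quad\text{whenever }u_t\to u\in\mathbb E_\gamma.\qquad(2)$$ Suppose that (1) and (2) hold, and write $G^*=\phi^*(1,\cdot)$ and $G=\phi(0,\cdot)$. Then $G=G^*$. If moreover $G^*$ is non-degenerate, in the sense that its restriction to $\mathbb R$ is not concentrated on a single point (and is not zero), then there are $\rho,k\in\mathbb R$ such that: (i) $\alpha,\beta$ are extended regularly varying with parameters $\rho,k$: for every $x>0$, as $t\to\infty$, $\alpha(tx)/\alpha(t)\to x^\rho$ and $(\beta(tx)-\beta(t))/\alpha(t)\to\psi(x)$, where $\psi(x)=k\rho^{-1}(x^\rho-1)$ if $\rho\ne0$ and $\psi(x)=k\log x$ if $\rho=0$; (ii) $\phi^*(u,A)=\kappa_{G^*}(u,A)$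 for all $u>0$ and Borel $A\subset[-\infty,\infty]$, where $\kappa_H(u,A)=H\big(u^{-\rho}[A-\psi(u)]\big)$ is the generalized tail kernel of a distribution $H$ on $[-\infty,\infty]$; (iii) $\phi(u,A)=\kappa_{G}\big((1+\gamma u)^{1/\gamma},A\big)$ for all $u\in\mathbb E_\gamma$ and Borel $A\subset[-\infty,\infty]$. -/

import Mathlib

open MeasureTheory ProbabilityTheory Filter Topology

noncomputable section

namespace KernelCEV

/-- The interval `E_γ = {y ∈ ℝ : 1 + γ y > 0}`. -/
def E (γ : ℝ) : Set ℝ := {y | 0 < 1 + γ * y}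

theorem zero_mem_E (γ : ℝ) : (0 : ℝ) ∈ E γ := by simp [E]

/-- The function `(1 + γ y)^{1/γ}`, read as `e^y` when `γ = 0`; it maps `E_γ` onto `(0, ∞)`. -/
def gev (γ y : ℝ) : ℝ := if γ = 0 then Real.exp y else (1 + γ * y) ^ (1 / γ)

theorem gev_pos {γ y : ℝ} (hy : y ∈ E γ) : 0 < gev γ y := by
  unfold gev
  split_ifs
  · exact Real.exp_pos y
  · exact Real.rpow_pos_of_pos hy _

/-- The distribution of the random variable `Y` is in the domain of attraction of the extreme value
distribution `G_γ`, with normalizing functions `a` and `b`: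
`t P[Y > a(t) y + b(t)] → (1 + γ y)^{-1/γ}` for every `y ∈ E_γ`. -/
def InDomainOfAttraction {Ω : Type*} [MeasurableSpace Ω] (P : Measure Ω) (Y : Ω → ℝ)
    (γ : ℝ) (a b : ℝ → ℝ) : Prop :=
  ∀ y ∈ E γ, Tendsto (fun t : ℝ => t * P.real {ω | a t * y + b t < Y ω}) atTop
    (𝓝 (gev γ y)⁻¹)

/-- The function `ψ(x) = k (x^ρ - 1) / ρ`, read as `k log x` when `ρ = 0`. -/
def psi (ρ k x : ℝ) : ℝ := if ρ = 0 then k * Real.log x else k * ρ⁻¹ * (x ^ ρ - 1)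

/-- The pair `(a, f)` of functions on `(0, ∞)` is extended regularly varying with
parameters `ρ, k`. -/
def ERV (a f : ℝ → ℝ) (ρ k : ℝ) : Prop :=
  ∀ x : ℝ, 0 < x →
    Tendsto (fun t => a (t * x) / a t) atTop (𝓝 (x ^ ρ)) ∧
    Tendsto (fun t => (f (t * x) - f t) / a t) atTop (𝓝 (psi ρ k x))

theorem measurable_rescale (c d : ℝ) :
    Measurable (fun z : EReal => (z - (d : EReal)) / (c : EReal)) := by
  simp only [sub_eq_add_neg, div_eq_mul_inv]
  fun_prop

/-- If `ξ` has law `μ` on `[-∞, ∞]`, this is the law of `(ξ - d) / c`. For `c > 0` its distribution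
function is `x ↦ μ [-∞, c x + d]`. -/
def rescale (μ : ProbabilityMeasure EReal) (c d : ℝ) : ProbabilityMeasure EReal :=
  μ.map (f := fun z : EReal => (z - (d : EReal)) / (c : EReal))
    (measurable_rescale c d).aemeasurable

/-- The probability measure `K(y, ·)` of a transition function `K`. -/
def law {D : Type*} [MeasurableSpace D] (K : Kernel D EReal) [IsMarkovKernel K] (y : D) :
    ProbabilityMeasure EReal := ⟨K y, inferInstance⟩

/-- The transition function `K*(y, ·) = K(b*(y), ·)`; only its values at `y > 0` matter. -/
def standardize (K : Kernel ℝ EReal) [IsMarkovKernel K] (bs : ℝ → ℝ) (y : ℝ) :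
    ProbabilityMeasure EReal := law K (bs y)

/-- `Q t (u t)` converges weakly on `[-∞, ∞]` to `φ(u₀, ·)` as `t → ∞`, whenever
`u t → u₀ ∈ D`. -/
def ConvergesTo (Q : ℝ → ℝ → ProbabilityMeasure EReal) (D : Set ℝ)
    (φ : Kernel D EReal) [IsMarkovKernel φ] : Prop :=
  ∀ (u : ℝ → ℝ) (u₀ : D), Tendsto u atTop (𝓝 (u₀ : ℝ)) →
    Tendsto (fun t => Q t (u t)) atTop (𝓝 (law φ u₀))

/-- The generalized tail kernel `κ_G(y, A) = G(y^{-ρ} [A - ψ(y)])`, that is, the law of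
`y^ρ ξ + ψ(y)` when `ξ` has law `G` on `[-∞, ∞]`. -/
def tailKernel (ρ k : ℝ) (G : Measure EReal) (y : ℝ) : Measure EReal :=
  G.map (fun z : EReal => ((y ^ ρ : ℝ) : EReal) * z + ((psi ρ k y : ℝ) : EReal))

/-- A distribution `G` on `[-∞, ∞]` is non-degenerate if its restriction to `ℝ` is not
concentrated on a single point (in particular the restriction is not zero). -/
def NonDegenerate (G : Measure EReal) : Prop :=
  ∀ c : ℝ, G {z : EReal | z ≠ ⊥ ∧ z ≠ ⊤ ∧ z ≠ (c : EReal)} ≠ 0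

end KernelCEV

end

noncomputable section

namespace KernelCEV

/-! The equivalence of (1) and (2) is a change of variable. Tail convergence inverts to `(b*(t u_t)
- b(t))/a(t) → gevInv γ u` (`tendsto_normalized`), so a path of (1) is a path of (2); the
intermediate value theorem gives the converse (`exists_path`). Hence `φ(v) = φ*(gev γ v)`, and `gev
γ 0 = 1` gives `G = G*`.

The rest is convergence of types for `K*(tu)`: normed at `t` it tends to `φ*(u)`, normed at `tu` to
`G*`. Only `G*` is known to be non-degenerate, so a direct comparison works only as `u → 1`, where
both limits are `G*` (`tendsto_rescale_self`, `tendsto_rescale_tendsto` in the form of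
`tendsto_of_rescale_tendsto`). It bounds the norming ratios for `u` near 1; compactness then makes
them converge, and the cocycle relation carries this from `u^(1/n)` to `u`. The limits solve
Cauchy-type equations and are continuous at 1, which yields `x^ρ` and `ψ`. -/

/-! ### Convergence of types on the extended line. -/

theorem NonDegenerate.exists_lt_forall_nhds_ne_zero {G : Measure EReal} (hG : NonDegenerate G) :
    ∃ s₁ s₂ : ℝ, s₁ < s₂ ∧ (∀ U ∈ 𝓝 (s₁ : EReal), G U ≠ 0) ∧ ∀ U ∈ 𝓝 (s₂ : EReal), G U ≠ 0 := by
  have key : ∀ c : ℝ, ∃ s : ℝ, s ≠ c ∧ ∀ U ∈ 𝓝 (s : EReal), G U ≠ 0 := by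
    intro c
    by_contra! hcon
    -- If no real point other than `c` were in the support, the Lindelöf property would make the
    -- whole of `ℝ` minus `c` null.
    refine hG c (measure_null_of_locally_null _ fun z hz => ?_)
    obtain ⟨h1, h2, h3⟩ := hz
    lift z to ℝ using ⟨h2, h1⟩
    obtain ⟨U, hU, hU0⟩ := hcon z (by simpa using h3)
    exact ⟨U, mem_nhdsWithin_of_mem_nhds hU, hU0⟩
  obtain ⟨s, -, hs⟩ := key 0
  obtain ⟨s', hne, hs'⟩ := key s
  rcases lt_or_gt_of_ne hne with h | h
  · exact ⟨s', s, h, hs', hs⟩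
  · exact ⟨s, s', h, hs, hs'⟩

theorem rescale_apply {μ : ProbabilityMeasure EReal} {c d : ℝ} {s : Set EReal}
    (hs : MeasurableSet s) :
    (rescale μ c d : Measure EReal) s
      = (μ : Measure EReal) ((fun z : EReal => (z - (d : EReal)) / (c : EReal)) ⁻¹' s) := by
  rw [rescale, ProbabilityMeasure.toMeasure_map, Measure.map_apply (measurable_rescale c d) hs]

theorem rescale_lt_iff {c d x : ℝ} (hc : 0 < c) (z : EReal) :
    (z - (d : EReal)) / (c : EReal) < x ↔ z < ((c * x + d : ℝ) : EReal) := by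
  induction z with
  | bot =>
    simp only [EReal.bot_sub, EReal.bot_div_of_pos_ne_top (EReal.coe_pos.2 hc) (EReal.coe_ne_top c),
      EReal.bot_lt_coe]
  | top =>
    simp only [EReal.top_sub_coe, EReal.top_div_of_pos_ne_top (EReal.coe_pos.2 hc) (EReal.coe_ne_top c),
      not_top_lt]
  | coe z =>
    rw [← EReal.coe_sub, ← EReal.coe_div, EReal.coe_lt_coe_iff, EReal.coe_lt_coe_iff, div_lt_iff₀ hc]
    constructor <;> intro <;> linarith

theorem rescale_le_iff {c d x : ℝ} (hc : 0 < c) (z : EReal) :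
    (z - (d : EReal)) / (c : EReal) ≤ x ↔ z ≤ ((c * x + d : ℝ) : EReal) := by
  induction z with
  | bot => simp [EReal.bot_div_of_pos_ne_top, hc]
  | top =>
    simp only [EReal.top_sub_coe, EReal.top_div_of_pos_ne_top (EReal.coe_pos.2 hc) (EReal.coe_ne_top c),
      top_le_iff, EReal.coe_ne_top]
  | coe z =>
    rw [← EReal.coe_sub, ← EReal.coe_div, EReal.coe_le_coe_iff, EReal.coe_le_coe_iff, div_le_iff₀ hc]
    constructor <;> intro <;> linarith

theorem rescale_Iio {μ : ProbabilityMeasure EReal} {c d : ℝ} (hc : 0 < c) (x : ℝ) :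
    (rescale μ c d : Measure EReal) (Set.Iio (x : EReal))
      = (μ : Measure EReal) (Set.Iio ((c * x + d : ℝ) : EReal)) := by
  rw [rescale_apply measurableSet_Iio]
  congr 1
  ext z
  exact rescale_lt_iff hc z

theorem rescale_Iic {μ : ProbabilityMeasure EReal} {c d : ℝ} (hc : 0 < c) (x : ℝ) :
    (rescale μ c d : Measure EReal) (Set.Iic (x : EReal))
      = (μ : Measure EReal) (Set.Iic ((c * x + d : ℝ) : EReal)) := by
  rw [rescale_apply measurableSet_Iic]
  congr 1
  ext z
  exact rescale_le_iff hc z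

/-- If `μ i` and `ν i` have the same weak limit, which charges every neighbourhood of a point `s`
strictly between `x` and `y`, then eventually `ν i [-∞, x] < μ i [-∞, y)`. -/
theorem eventually_Iic_lt_Iio {ι : Type*} {l : Filter ι} {μ ν : ι → ProbabilityMeasure EReal}
    {G : ProbabilityMeasure EReal} (hμ : Tendsto μ l (𝓝 G)) (hν : Tendsto ν l (𝓝 G))
    {x s y : ℝ} (hxs : x < s) (hsy : s < y)
    (hs : ∀ U ∈ 𝓝 (s : EReal), (G : Measure EReal) U ≠ 0) :
    ∀ᶠ i in l, (ν i : Measure EReal) (Set.Iic (x : EReal))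
      < (μ i : Measure EReal) (Set.Iio (y : EReal)) := by
  have hlt : (G : Measure EReal) (Set.Iic (x : EReal)) < (G : Measure EReal) (Set.Iio (y : EReal)) := by
    have h0 := hs (Set.Ioo (x : EReal) y)
      (Ioo_mem_nhds (EReal.coe_lt_coe_iff.2 hxs) (EReal.coe_lt_coe_iff.2 hsy))
    have hun : Set.Iio (y : EReal) = Set.Iic (x : EReal) ∪ Set.Ioo (x : EReal) y :=
      (Set.Iic_union_Ioo_eq_Iio (EReal.coe_lt_coe_iff.2 (hxs.trans hsy))).symm
    rw [hun, measure_union _ measurableSet_Ioo]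
    · exact ENNReal.lt_add_right (measure_ne_top _ _) h0
    · exact Set.disjoint_left.2 fun z hz hz' => (not_lt.2 hz) hz'.1
  obtain ⟨r, hr1, hr2⟩ := exists_between hlt
  have h1 := eventually_lt_of_limsup_lt
    ((ProbabilityMeasure.limsup_measure_closed_le_of_tendsto hν isClosed_Iic).trans_lt hr1)
  have h2 := eventually_lt_of_lt_liminf
    (hr2.trans_le (ProbabilityMeasure.le_liminf_measure_open_of_tendsto hμ isOpen_Iio))
  filter_upwards [h1, h2] with i hi1 hi2 using hi1.trans hi2

/-- Convergence of types towards a single non-degenerate law: if both `μ i` and its rescaled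
versions converge to `G`, then the rescaling is asymptotically trivial. -/
theorem tendsto_of_rescale_tendsto {ι : Type*} {l : Filter ι} {μ : ι → ProbabilityMeasure EReal}
    {G : ProbabilityMeasure EReal} (hG : NonDegenerate (G : Measure EReal)) {c d : ι → ℝ}
    (hc : ∀ᶠ i in l, 0 < c i) (hμ : Tendsto μ l (𝓝 G))
    (hν : Tendsto (fun i => rescale (μ i) (c i) (d i)) l (𝓝 G)) :
    Tendsto c l (𝓝 1) ∧ Tendsto d l (𝓝 0) := by
  obtain ⟨s₁, s₂, hlt, h₁, h₂⟩ := hG.exists_lt_forall_nhds_ne_zero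
  -- Masses order points: the rescaled law of `[-∞, s - ε]` is the `μ i` mass of `[-∞, c i * (s - ε)
  -- + d i]`, eventually less than that of `[-∞, s + ε)`.
  have up : ∀ s : ℝ, (∀ U ∈ 𝓝 (s : EReal), (G : Measure EReal) U ≠ 0) → ∀ ε > 0,
      ∀ᶠ i in l, c i * (s - ε) + d i < s + ε := by
    intro s hs ε hε
    filter_upwards [hc, eventually_Iic_lt_Iio hμ hν (sub_lt_self s hε) (lt_add_of_pos_right s hε) hs]
      with i hci hi
    rw [rescale_Iic hci] at hi
    by_contra! hle
    refine hi.not_ge (measure_mono fun z hz => ?_)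
    exact (le_of_lt hz).trans (EReal.coe_le_coe_iff.2 hle)
  have low : ∀ s : ℝ, (∀ U ∈ 𝓝 (s : EReal), (G : Measure EReal) U ≠ 0) → ∀ ε > 0,
      ∀ᶠ i in l, s - ε < c i * (s + ε) + d i := by
    intro s hs ε hε
    filter_upwards [hc, eventually_Iic_lt_Iio hν hμ (sub_lt_self s hε) (lt_add_of_pos_right s hε) hs]
      with i hci hi
    rw [rescale_Iio hci] at hi
    by_contra! hle
    refine hi.not_ge (measure_mono fun z hz => ?_)
    exact (le_of_lt hz).trans (EReal.coe_le_coe_iff.2 hle)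
  have hc1 : Tendsto c l (𝓝 1) := by
    set L := s₂ - s₁ with hL
    have hLpos : 0 < L := sub_pos.2 hlt
    have lim1 : Tendsto (fun ε : ℝ => (L - 2 * ε) / (L + 2 * ε)) (𝓝 0) (𝓝 1) := by
      have : ContinuousAt (fun ε : ℝ => (L - 2 * ε) / (L + 2 * ε)) 0 := by
        apply ContinuousAt.div (by fun_prop) (by fun_prop)
        simpa using hLpos.ne'
      simpa [ContinuousAt, hLpos.ne'] using this
    have lim2 : Tendsto (fun ε : ℝ => (L + 2 * ε) / (L - 2 * ε)) (𝓝 0) (𝓝 1) := by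
      have : ContinuousAt (fun ε : ℝ => (L + 2 * ε) / (L - 2 * ε)) 0 := by
        apply ContinuousAt.div (by fun_prop) (by fun_prop)
        simpa using hLpos.ne'
      simpa [ContinuousAt, hLpos.ne'] using this
    refine tendsto_order.2 ⟨fun r hr => ?_, fun r hr => ?_⟩
    · obtain ⟨ε, hεr, hε⟩ := ((lim1.eventually (lt_mem_nhds hr)).filter_mono
        (nhdsWithin_le_nhds (s := Set.Ioi 0)) |>.and self_mem_nhdsWithin).exists
      have hε : 0 < ε := hε
      -- Subtracting the bounds at the two support points eliminates `d i` and leaves bounds on `c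
      -- i` alone.
      filter_upwards [up s₁ h₁ ε hε, low s₂ h₂ ε hε] with i hi1 hi2
      refine hεr.trans ((div_lt_iff₀ (by positivity)).2 ?_)
      rw [hL]; linarith
    · obtain ⟨ε, ⟨hεr, hεL⟩, hε⟩ := (((lim2.eventually (gt_mem_nhds hr)).and
        (gt_mem_nhds (half_pos hLpos))).filter_mono
        (nhdsWithin_le_nhds (s := Set.Ioi 0)) |>.and self_mem_nhdsWithin).exists
      have hε : 0 < ε := hε
      filter_upwards [low s₁ h₁ ε hε, up s₂ h₂ ε hε] with i hi1 hi2
      refine lt_trans ((lt_div_iff₀ (by linarith)).2 ?_) hεr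
      rw [hL]; linarith
  refine ⟨hc1, tendsto_order.2 ⟨fun r hr => ?_, fun r hr => ?_⟩⟩
  · have hε : 0 < -r / 4 := by linarith
    have hlim : Tendsto (fun i => s₁ - (-r / 4) - c i * (s₁ + -r / 4)) l
        (𝓝 (s₁ - (-r / 4) - 1 * (s₁ + -r / 4))) := (hc1.mul_const _).const_sub _
    filter_upwards [low s₁ h₁ _ hε, hlim.eventually (lt_mem_nhds (show r < _ by linarith))] with i h h'
    linarith
  · have hε : 0 < r / 4 := by linarith
    have hlim : Tendsto (fun i => s₁ + r / 4 - c i * (s₁ - r / 4)) l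
        (𝓝 (s₁ + r / 4 - 1 * (s₁ - r / 4))) := (hc1.mul_const _).const_sub _
    filter_upwards [up s₁ h₁ _ hε, hlim.eventually (gt_mem_nhds (show _ < r by linarith))] with i h h'
    linarith

theorem rescale_rescale (μ : ProbabilityMeasure EReal) {c c' : ℝ} (hc : 0 < c) (hc' : 0 < c')
    (d d' : ℝ) : rescale (rescale μ c d) c' d' = rescale μ (c * c') (d + c * d') := by
  apply Subtype.ext
  simp only [rescale, ProbabilityMeasure.toMeasure_map, ProbabilityMeasure.val_eq_to_measure]
  rw [Measure.map_map (measurable_rescale _ _) (measurable_rescale _ _)]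
  congr 1
  ext z
  have hcc : 0 < c * c' := mul_pos hc hc'
  induction z with
  | bot =>
    simp only [Function.comp, EReal.bot_sub,
      EReal.bot_div_of_pos_ne_top (EReal.coe_pos.2 hc) (EReal.coe_ne_top c),
      EReal.bot_div_of_pos_ne_top (EReal.coe_pos.2 hc') (EReal.coe_ne_top c'),
      EReal.bot_div_of_pos_ne_top (EReal.coe_pos.2 hcc) (EReal.coe_ne_top (c * c'))]
  | top =>
    simp only [Function.comp, EReal.top_sub_coe,
      EReal.top_div_of_pos_ne_top (EReal.coe_pos.2 hc) (EReal.coe_ne_top c),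
      EReal.top_div_of_pos_ne_top (EReal.coe_pos.2 hc') (EReal.coe_ne_top c'),
      EReal.top_div_of_pos_ne_top (EReal.coe_pos.2 hcc) (EReal.coe_ne_top (c * c'))]
  | coe z =>
    simp only [Function.comp, ← EReal.coe_sub, ← EReal.coe_div, EReal.coe_eq_coe_iff]
    field_simp
    ring

theorem map_affine_rescale (μ : ProbabilityMeasure EReal) {c : ℝ} (hc : 0 < c) (d : ℝ) :
    (rescale μ c d : Measure EReal).map (fun z : EReal => (c : EReal) * z + (d : EReal))
      = (μ : Measure EReal) := by
  have hm : Measurable (fun z : EReal => (c : EReal) * z + (d : EReal)) := by fun_prop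
  rw [rescale, ProbabilityMeasure.toMeasure_map, Measure.map_map hm (measurable_rescale _ _)]
  convert Measure.map_id
  ext z
  induction z with
  | bot =>
    simp only [Function.comp, EReal.bot_sub, id,
      EReal.bot_div_of_pos_ne_top (EReal.coe_pos.2 hc) (EReal.coe_ne_top c),
      EReal.coe_mul_bot_of_pos hc, EReal.bot_add]
  | top =>
    simp only [Function.comp, EReal.top_sub_coe, id,
      EReal.top_div_of_pos_ne_top (EReal.coe_pos.2 hc) (EReal.coe_ne_top c),
      EReal.coe_mul_top_of_pos hc, EReal.top_add_coe]
  | coe z =>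
    simp only [Function.comp, ← EReal.coe_sub, ← EReal.coe_div, id, ← EReal.coe_mul, ← EReal.coe_add,
      EReal.coe_eq_coe_iff]
    field_simp
    ring

/-- A finite shift and a finite nonzero factor avoid every discontinuity of addition and
multiplication on `EReal`. -/
theorem continuous_rescale_uncurry :
    Continuous (fun p : (Set.Ioi (0 : ℝ) × ℝ) × EReal =>
      (p.2 - (p.1.2 : EReal)) / ((p.1.1 : ℝ) : EReal)) := by
  have hsub : Continuous (fun p : (Set.Ioi (0 : ℝ) × ℝ) × EReal => p.2 - (p.1.2 : EReal)) := by
    rw [continuous_iff_continuousAt]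
    intro p
    simp only [sub_eq_add_neg, ← EReal.coe_neg]
    have h := EReal.continuousAt_add (p := (p.2, ((-p.1.2 : ℝ) : EReal)))
      (Or.inr (EReal.coe_ne_bot _)) (Or.inr (EReal.coe_ne_top _))
    exact ContinuousAt.comp (f := fun p : (Set.Ioi (0 : ℝ) × ℝ) × EReal =>
      (p.2, ((-p.1.2 : ℝ) : EReal))) (x := p) h
      (Continuous.continuousAt (continuous_snd.prodMk (continuous_coe_real_ereal.comp (by fun_prop))))
  have hinv : Continuous (fun p : (Set.Ioi (0 : ℝ) × ℝ) × EReal => (((p.1.1 : ℝ)⁻¹ : ℝ) : EReal)) := by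
    refine continuous_coe_real_ereal.comp (Continuous.inv₀ (by fun_prop) fun p => ?_)
    exact ne_of_gt p.1.1.2
  rw [continuous_iff_continuousAt]
  intro p
  simp only [div_eq_mul_inv, ← EReal.coe_inv]
  have hne : (((p.1.1 : ℝ)⁻¹ : ℝ) : EReal) ≠ 0 := by
    have : (0 : ℝ) < p.1.1 := p.1.1.2
    exact_mod_cast (inv_pos.2 this).ne'
  exact ContinuousAt.comp (f := fun p : (Set.Ioi (0 : ℝ) × ℝ) × EReal =>
      (p.2 - (p.1.2 : EReal), (((p.1.1 : ℝ)⁻¹ : ℝ) : EReal))) (x := p)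
      (EReal.continuousAt_mul (Or.inr (EReal.coe_ne_bot _)) (Or.inr (EReal.coe_ne_top _))
      (Or.inr hne) (Or.inr hne)) (hsub.prodMk hinv).continuousAt

/-- Since `EReal` is compact, joint continuity makes the rescaled test functions converge uniformly,
so replacing `(c i, d i)` by the limit changes the integrals by `o(1)`. -/
theorem tendsto_rescale {ι : Type*} {l : Filter ι} {μ : ι → ProbabilityMeasure EReal}
    {ν : ProbabilityMeasure EReal} (hμ : Tendsto μ l (𝓝 ν)) {c d : ι → ℝ} {c₀ d₀ : ℝ}
    (hc₀ : 0 < c₀) (hc : Tendsto c l (𝓝 c₀)) (hd : Tendsto d l (𝓝 d₀)) :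
    Tendsto (fun i => rescale (μ i) (c i) (d i)) l (𝓝 (rescale ν c₀ d₀)) := by
  rw [ProbabilityMeasure.tendsto_iff_forall_integral_tendsto] at hμ ⊢
  intro f
  have hint : ∀ (μ : ProbabilityMeasure EReal) (c d : ℝ),
      ∫ z, f z ∂(rescale μ c d : Measure EReal)
        = ∫ z, f ((z - (d : EReal)) / (c : EReal)) ∂(μ : Measure EReal) := by
    intro μ c d
    rw [rescale, ProbabilityMeasure.toMeasure_map,
      integral_map (measurable_rescale c d).aemeasurable f.continuous.aestronglyMeasurable]
  simp only [hint]
  let F : C((Set.Ioi (0 : ℝ) × ℝ) × EReal, ℝ) :=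
    ⟨fun p => f ((p.2 - (p.1.2 : EReal)) / ((p.1.1 : ℝ) : EReal)),
      f.continuous.comp continuous_rescale_uncurry⟩
  let pos : ℝ → Set.Ioi (0 : ℝ) := fun x => if h : 0 < x then ⟨x, h⟩ else ⟨1, Set.mem_Ioi.2 one_pos⟩
  have hpos : ∀ x, 0 < x → (pos x : ℝ) = x := fun x hx => by simp [pos, hx]
  have hcpos : ∀ᶠ i in l, 0 < c i := hc.eventually (lt_mem_nhds hc₀)
  have hlim : Tendsto (fun i => F.curry (pos (c i), d i)) l (𝓝 (F.curry (pos c₀, d₀))) := by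
    refine (F.curry.continuous.tendsto _).comp (Tendsto.prodMk_nhds ?_ hd)
    rw [tendsto_subtype_rng, hpos _ hc₀]
    exact hc.congr' (hcpos.mono fun i hi => (hpos _ hi).symm)
  have hdist := (tendsto_iff_dist_tendsto_zero.1 hlim)
  have h0 := hμ (BoundedContinuousFunction.mkOfCompact (F.curry (pos c₀, d₀)))
  have hF : ∀ c d, 0 < c → ∀ z : EReal,
      F.curry (pos c, d) z = f ((z - (d : EReal)) / (c : EReal)) := by
    intro c d hc z
    change f ((z - (d : EReal)) / (((pos c : ℝ)) : EReal)) = _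
    rw [hpos c hc]
  simp only [BoundedContinuousFunction.mkOfCompact_apply, hF _ _ hc₀] at h0
  have hdiff : Tendsto (fun i => ∫ z, f ((z - (d i : EReal)) / (c i : EReal)) ∂(μ i : Measure EReal)
      - ∫ z, f ((z - (d₀ : EReal)) / (c₀ : EReal)) ∂(μ i : Measure EReal)) l (𝓝 0) := by
    refine squeeze_zero_norm' ?_ hdist
    filter_upwards [hcpos] with i hi
    have hI : ∀ c d : ℝ, 0 < c → Integrable (fun z : EReal => f ((z - (d : EReal)) / (c : EReal)))
        (μ i : Measure EReal) := by
      intro c d hc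
      simp only [← hF c d hc]
      exact (BoundedContinuousFunction.mkOfCompact (F.curry (pos c, d))).integrable _
    rw [← integral_sub (hI _ _ hi) (hI _ _ hc₀)]
    refine (norm_integral_le_of_norm_le_const (C := dist (F.curry (pos (c i), d i))
      (F.curry (pos c₀, d₀))) (ae_of_all _ fun z => ?_)).trans (by simp)
    rw [← hF _ _ hi, ← hF _ _ hc₀, ← dist_eq_norm]
    exact ContinuousMap.dist_apply_le_dist z
  simpa using hdiff.add h0

/-- Sequential criterion: convergence along every path `t ↦ u t` tending to `u₀` gives convergence
jointly in `(t, u)`. -/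
theorem tendsto_prod_of_forall_path {X : Type*} {F : ℝ → ℝ → X} {l : Filter X} {u₀ : ℝ}
    (h : ∀ u : ℝ → ℝ, Tendsto u atTop (𝓝 u₀) → Tendsto (fun t => F t (u t)) atTop l) :
    Tendsto (fun p : ℝ × ℝ => F p.1 p.2) (atTop ×ˢ 𝓝 u₀) l := by
  refine tendsto_of_seq_tendsto fun x hx => tendsto_of_subseq_tendsto fun ns hns => ?_
  have hx' := hx.comp hns
  have ht : Tendsto (fun n => (x (ns n)).1) atTop atTop := tendsto_fst.comp hx'
  have hu : Tendsto (fun n => (x (ns n)).2) atTop (𝓝 u₀) := tendsto_snd.comp hx'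
  -- Strictly increasing times are distinct, so a single path can pass through all the points;
  -- elsewhere it is constantly `u₀`.
  obtain ⟨φ, hφ, hmono⟩ := strictMono_subseq_of_tendsto_atTop ht
  refine ⟨φ, ?_⟩
  set τ : ℕ → ℝ := fun n => (x (ns (φ n))).1
  have hinj : Function.Injective τ := hmono.injective
  let u : ℝ → ℝ := Function.extend τ (fun n => (x (ns (φ n))).2) (fun _ => u₀)
  have huτ : ∀ n, u (τ n) = (x (ns (φ n))).2 := fun n => hinj.extend_apply _ _ n
  have hulim : Tendsto u atTop (𝓝 u₀) := by
    refine tendsto_def.2 fun V hV => ?_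
    obtain ⟨N, hN⟩ := eventually_atTop.1 ((hu.comp hφ.tendsto_atTop).eventually hV)
    filter_upwards [eventually_gt_atTop (τ N)] with t htN
    by_cases hex : ∃ n, τ n = t
    · obtain ⟨n, rfl⟩ := hex
      rw [Set.mem_preimage, huτ]
      exact hN n (hmono.lt_iff_lt.1 htN).le
    · rw [Set.mem_preimage, show u t = u₀ from Function.extend_apply' _ _ _ hex]
      exact mem_of_mem_nhds hV
  have := (h u hulim).comp (ht.comp hφ.tendsto_atTop)
  refine this.congr fun n => ?_
  change F (τ n) (u (τ n)) = _
  rw [huτ]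
  rfl

/-! ### The change of variable `gev` and its inverse. -/

/-- The inverse of `gev γ`, defined on `(0, ∞)`. -/
def gevInv (γ u : ℝ) : ℝ := if γ = 0 then Real.log u else (u ^ γ - 1) / γ

theorem isOpen_E (γ : ℝ) : IsOpen (E γ) := isOpen_lt (by fun_prop) (by fun_prop)

theorem one_add_mul_gevInv {γ u : ℝ} (hγ : γ ≠ 0) : 1 + γ * gevInv γ u = u ^ γ := by
  rw [gevInv, if_neg hγ]
  field_simp
  ring

theorem gevInv_mem {γ u : ℝ} (hu : 0 < u) : gevInv γ u ∈ E γ := by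
  by_cases hγ : γ = 0
  · simp [E, hγ]
  · rw [E, Set.mem_ofPred_eq, one_add_mul_gevInv hγ]
    exact Real.rpow_pos_of_pos hu _

theorem gev_gevInv {γ u : ℝ} (hu : 0 < u) : gev γ (gevInv γ u) = u := by
  by_cases hγ : γ = 0
  · simp [gev, gevInv, hγ, Real.exp_log hu]
  · rw [gev, if_neg hγ, one_add_mul_gevInv hγ, ← Real.rpow_mul hu.le, mul_one_div_cancel hγ,
      Real.rpow_one]

theorem gevInv_gev {γ y : ℝ} (hy : y ∈ E γ) : gevInv γ (gev γ y) = y := by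
  by_cases hγ : γ = 0
  · simp [gev, gevInv, hγ]
  · have hy' : 0 < 1 + γ * y := hy
    rw [gev, gevInv, if_neg hγ, if_neg hγ, ← Real.rpow_mul hy'.le, one_div_mul_cancel hγ,
      Real.rpow_one]
    field_simp
    ring

theorem strictMonoOn_gevInv (γ : ℝ) : StrictMonoOn (gevInv γ) (Set.Ioi 0) := by
  intro x hx y hy hxy
  have hx : 0 < x := hx
  unfold gevInv
  rcases lt_trichotomy γ 0 with h | h | h
  · rw [if_neg h.ne, if_neg h.ne, div_lt_div_right_of_neg h]
    exact sub_lt_sub_right (Real.rpow_lt_rpow_of_neg hx hxy h) 1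
  · rw [if_pos h, if_pos h]
    exact Real.log_lt_log hx hxy
  · rw [if_neg h.ne', if_neg h.ne', div_lt_div_iff_of_pos_right h]
    exact sub_lt_sub_right (Real.rpow_lt_rpow hx.le hxy h) 1

theorem strictMonoOn_gev (γ : ℝ) : StrictMonoOn (gev γ) (E γ) := by
  intro x hx y hy hxy
  by_contra! hle
  have := (strictMonoOn_gevInv γ).monotoneOn (gev_pos hy) (gev_pos hx) hle
  rw [gevInv_gev hx, gevInv_gev hy] at this
  exact hxy.not_ge this

theorem gev_zero (γ : ℝ) : gev γ 0 = 1 := by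
  simp [gev]

theorem measurable_gev (γ : ℝ) : Measurable (gev γ) := by
  unfold gev
  split_ifs <;> fun_prop

theorem measurable_gevInv (γ : ℝ) : Measurable (gevInv γ) := by
  unfold gevInv
  split_ifs <;> fun_prop

theorem continuousAt_gev {γ y : ℝ} (hy : y ∈ E γ) : ContinuousAt (gev γ) y := by
  unfold gev
  split_ifs
  · fun_prop
  · exact ContinuousAt.rpow_const (by fun_prop) (Or.inl (ne_of_gt hy))

/-! ### Paths in the domain of attraction. -/

variable {Ω : Type*} [MeasurableSpace Ω] {P : Measure Ω} [IsProbabilityMeasure P] {Y : Ω → ℝ}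
  {γ : ℝ} {a b bs : ℝ → ℝ}

theorem antitone_scaled_tail (Y : Ω → ℝ) {t A B : ℝ} (ht : 0 < t) (hA : 0 < A) :
    Antitone (fun y => t * P.real {ω | A * y + B < Y ω}) := by
  intro x y hxy
  refine mul_le_mul_of_nonneg_left (measureReal_mono fun ω hω => ?_) ht.le
  have hω : A * y + B < Y ω := hω
  exact lt_of_le_of_lt (by gcongr) hω

/-- The convergence defining the domain of attraction, at `0` and along a perturbation of `b`. -/
theorem InDomainOfAttraction.tendsto_tail (hdoa : InDomainOfAttraction P Y γ a b)
    (ha : ∀ t, 0 < t → 0 < a t) (hbs : Tendsto (fun t => (bs t - b t) / a t) atTop (𝓝 0)) :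
    Tendsto (fun t => t * P.real {ω | bs t < Y ω}) atTop (𝓝 1) := by
  have hcont : ContinuousAt (fun y => (gev γ y)⁻¹) 0 :=
    (continuousAt_gev (zero_mem_E γ)).inv₀ (by simp [gev_zero])
  have hE : ∀ᶠ y in 𝓝 (0 : ℝ), y ∈ E γ := (isOpen_E γ).mem_nhds (zero_mem_E γ)
  have hrew : ∀ t, 0 < t → a t * ((bs t - b t) / a t) + b t = bs t := by
    intro t ht
    have := (ha t ht).ne'
    field_simp
    ring
  refine tendsto_order.2 ⟨fun r hr => ?_, fun r hr => ?_⟩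
  · have h1 : ∀ᶠ y in 𝓝 (0 : ℝ), r < (gev γ y)⁻¹ :=
      hcont.eventually (lt_mem_nhds (by simpa [gev_zero] using hr))
    -- The tail is antitone in its level, so a fixed level slightly above 0 bounds the moving
    -- level's tail from below.
    obtain ⟨y, ⟨hyr, hyE⟩, hy0⟩ := ((h1.and hE).filter_mono
      (nhdsWithin_le_nhds (s := Set.Ioi 0)) |>.and self_mem_nhdsWithin).exists
    filter_upwards [(hdoa y hyE).eventually (lt_mem_nhds hyr), eventually_gt_atTop 0,
      hbs.eventually (gt_mem_nhds hy0)] with t h2 ht h3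
    have := antitone_scaled_tail (P := P) Y (B := b t) ht (ha t ht) h3.le
    simp only [hrew t ht] at this
    exact h2.trans_le this
  · have h1 : ∀ᶠ y in 𝓝 (0 : ℝ), (gev γ y)⁻¹ < r :=
      hcont.eventually (gt_mem_nhds (by simpa [gev_zero] using hr))
    obtain ⟨y, ⟨hyr, hyE⟩, hy0⟩ := ((h1.and hE).filter_mono
      (nhdsWithin_le_nhds (s := Set.Iio 0)) |>.and self_mem_nhdsWithin).exists
    filter_upwards [(hdoa y hyE).eventually (gt_mem_nhds hyr), eventually_gt_atTop 0,
      hbs.eventually (lt_mem_nhds hy0)] with t h2 ht h3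
    have := antitone_scaled_tail (P := P) Y (B := b t) ht (ha t ht) h3.le
    simp only [hrew t ht] at this
    exact this.trans_lt h2

/-- Tail asymptotics at time `t u_t` give `t P[Y > b*(t u_t)] → 1/u₀`. Limits at fixed levels are
strictly decreasing in the level, which traps the normalized level around `gevInv γ u₀`. -/
theorem InDomainOfAttraction.tendsto_normalized (hdoa : InDomainOfAttraction P Y γ a b)
    (ha : ∀ t, 0 < t → 0 < a t) (hbs : Tendsto (fun t => (bs t - b t) / a t) atTop (𝓝 0))
    {u : ℝ → ℝ} {u₀ : ℝ} (hu₀ : 0 < u₀) (hu : Tendsto u atTop (𝓝 u₀)) :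
    Tendsto (fun t => (bs (t * u t) - b t) / a t) atTop (𝓝 (gevInv γ u₀)) := by
  have hrew : ∀ t, 0 < t → a t * ((bs (t * u t) - b t) / a t) + b t = bs (t * u t) := by
    intro t ht
    have := (ha t ht).ne'
    field_simp
    ring
  have htu : Tendsto (fun t => t * u t) atTop atTop := tendsto_id.atTop_mul_pos hu₀ hu
  have hlim : Tendsto (fun t => t * P.real {ω | bs (t * u t) < Y ω}) atTop (𝓝 u₀⁻¹) := by
    have h := ((hdoa.tendsto_tail ha hbs).comp htu).mul (hu.inv₀ hu₀.ne')
    rw [one_mul] at h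
    refine h.congr' ?_
    filter_upwards [hu.eventually (lt_mem_nhds hu₀)] with t ht
    simp only [Function.comp]
    field_simp
  have hw := gevInv_mem (γ := γ) hu₀
  have hE : ∀ᶠ y in 𝓝 (gevInv γ u₀), y ∈ E γ := (isOpen_E γ).mem_nhds hw
  refine tendsto_order.2 ⟨fun r hr => ?_, fun r hr => ?_⟩
  · obtain ⟨y, ⟨hyE, hry⟩, hyw⟩ := ((hE.and (lt_mem_nhds hr)).filter_mono
      (nhdsWithin_le_nhds (s := Set.Iio (gevInv γ u₀))) |>.and self_mem_nhdsWithin).exists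
    have hlt : u₀⁻¹ < (gev γ y)⁻¹ := by
      refine inv_strictAnti₀ (gev_pos hyE) ?_
      have := strictMonoOn_gev γ hyE hw hyw
      rwa [gev_gevInv hu₀] at this
    obtain ⟨q, hq1, hq2⟩ := exists_between hlt
    filter_upwards [(hdoa y hyE).eventually (lt_mem_nhds hq2), eventually_gt_atTop 0,
      hlim.eventually (gt_mem_nhds hq1)] with t h2 ht h3
    by_contra! hle
    have := antitone_scaled_tail (P := P) Y (B := b t) ht (ha t ht) (hle.trans hry.le)
    simp only [hrew t ht] at this
    linarith
  · obtain ⟨y, ⟨hyE, hry⟩, hyw⟩ := ((hE.and (gt_mem_nhds hr)).filter_mono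
      (nhdsWithin_le_nhds (s := Set.Ioi (gevInv γ u₀))) |>.and self_mem_nhdsWithin).exists
    have hlt : (gev γ y)⁻¹ < u₀⁻¹ := by
      refine inv_strictAnti₀ hu₀ ?_
      have := strictMonoOn_gev γ hw hyE hyw
      rwa [gev_gevInv hu₀] at this
    obtain ⟨q, hq1, hq2⟩ := exists_between hlt
    filter_upwards [(hdoa y hyE).eventually (gt_mem_nhds hq1), eventually_gt_atTop 0,
      hlim.eventually (lt_mem_nhds hq2)] with t h2 ht h3
    by_contra! hle
    have := antitone_scaled_tail (P := P) Y (B := b t) ht (ha t ht) (hry.le.trans hle)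
    simp only [hrew t ht] at this
    linarith

/-- Every path `a(t) v(t) + b(t)` with `v(t) → v₀ ∈ E γ` is of the form `b*(t s(t))`
with `s(t) → gev γ v₀`. -/
theorem InDomainOfAttraction.exists_path (hdoa : InDomainOfAttraction P Y γ a b)
    (ha : ∀ t, 0 < t → 0 < a t) (hbs_cont : ContinuousOn bs (Set.Ioi 0))
    (hbs_mono : StrictMonoOn bs (Set.Ioi 0))
    (hbs : Tendsto (fun t => (bs t - b t) / a t) atTop (𝓝 0))
    {v : ℝ → ℝ} {v₀ : ℝ} (hv₀ : v₀ ∈ E γ) (hv : Tendsto v atTop (𝓝 v₀)) :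
    ∃ s : ℝ → ℝ, Tendsto s atTop (𝓝 (gev γ v₀)) ∧
      ∀ᶠ t in atTop, bs (t * s t) = a t * v t + b t := by
  have key : ∀ x y : ℝ, 0 < x → x < gev γ v₀ → gev γ v₀ < y → ∀ᶠ t in atTop,
      0 < t ∧ bs (t * x) < a t * v t + b t ∧ a t * v t + b t < bs (t * y) := by
    intro x y hx hxg hgy
    have hxw := strictMonoOn_gevInv γ hx (gev_pos hv₀) hxg
    have hyw := strictMonoOn_gevInv γ (gev_pos hv₀) ((gev_pos hv₀).trans hgy) hgy
    rw [gevInv_gev hv₀] at hxw hyw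
    have h1 := hdoa.tendsto_normalized ha hbs hx (tendsto_const_nhds (x := x))
    have h2 := hdoa.tendsto_normalized ha hbs ((gev_pos hv₀).trans hgy) (tendsto_const_nhds (x := y))
    filter_upwards [h1.eventually_lt hv hxw, hv.eventually_lt h2 hyw, eventually_gt_atTop 0]
      with t ht1 ht2 ht
    rw [div_lt_iff₀ (ha t ht)] at ht1
    rw [lt_div_iff₀ (ha t ht)] at ht2
    exact ⟨ht, by linarith, by linarith⟩
  have hex : ∀ t, ∃ s, (∃ r, 0 < r ∧ bs (t * r) = a t * v t + b t) →
      0 < s ∧ bs (t * s) = a t * v t + b t := by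
    intro t
    by_cases h : ∃ r, 0 < r ∧ bs (t * r) = a t * v t + b t
    · exact ⟨h.choose, fun _ => h.choose_spec⟩
    · exact ⟨0, fun h' => (h h').elim⟩
  choose s hs using hex
  have main : ∀ x y : ℝ, 0 < x → x < gev γ v₀ → gev γ v₀ < y → ∀ᶠ t in atTop,
      bs (t * s t) = a t * v t + b t ∧ x < s t ∧ s t < y := by
    intro x y hx hxg hgy
    filter_upwards [key x y hx hxg hgy] with t ht
    obtain ⟨ht0, ht1, ht2⟩ := ht
    have hy : 0 < y := hx.trans (hxg.trans hgy)
    have hsub : Set.Icc (t * x) (t * y) ⊆ Set.Ioi 0 := fun z hz => (mul_pos ht0 hx).trans_le hz.1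
    obtain ⟨z, hz, hbz⟩ := intermediate_value_Icc
      (mul_le_mul_of_nonneg_left (hxg.trans hgy).le ht0.le) (hbs_cont.mono hsub)
      ⟨ht1.le, ht2.le⟩
    have hz0 : 0 < z := hsub hz
    obtain ⟨hs0, hsb⟩ := hs t ⟨z / t, div_pos hz0 ht0, by rwa [mul_div_cancel₀ _ ht0.ne']⟩
    refine ⟨hsb, ?_, ?_⟩
    · rw [← hsb] at ht1
      exact lt_of_mul_lt_mul_left ((hbs_mono.lt_iff_lt (mul_pos ht0 hx) (mul_pos ht0 hs0)).1 ht1)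
        ht0.le
    · rw [← hsb] at ht2
      exact lt_of_mul_lt_mul_left ((hbs_mono.lt_iff_lt (mul_pos ht0 hs0) (mul_pos ht0 hy)).1 ht2)
        ht0.le
  have hg := gev_pos hv₀
  refine ⟨s, tendsto_order.2 ⟨fun r hr => ?_, fun r hr => ?_⟩, ?_⟩
  -- The maximum keeps the lower end of the bracket positive even if `r ≤ 0`.
  · filter_upwards [main (max r (gev γ v₀ / 2)) (gev γ v₀ + 1) (lt_max_of_lt_right (half_pos hg))
      (max_lt hr (half_lt_self hg)) (lt_add_one _)] with t ht
    exact (le_max_left _ _).trans_lt ht.2.1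
  · exact (main _ r (half_pos hg) (half_lt_self hg) hr).mono fun t ht => ht.2.2
  · exact (main _ _ (half_pos hg) (half_lt_self hg) (lt_add_one _)).mono fun t ht => ht.1

/-! ### Transfer of convergence between the two parametrizations. -/

variable {K : Kernel ℝ EReal} [IsMarkovKernel K] {α β : ℝ → ℝ}

theorem ConvergesTo.of_standardized (hdoa : InDomainOfAttraction P Y γ a b)
    (ha : ∀ t, 0 < t → 0 < a t) (hbs_cont : ContinuousOn bs (Set.Ioi 0))
    (hbs_mono : StrictMonoOn bs (Set.Ioi 0))
    (hbs : Tendsto (fun t => (bs t - b t) / a t) atTop (𝓝 0))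
    {φs : Kernel (Set.Ioi (0 : ℝ)) EReal} [IsMarkovKernel φs]
    (h : ConvergesTo (fun t u => rescale (standardize K bs (t * u)) (α t) (β t)) (Set.Ioi 0) φs)
    {v : ℝ → ℝ} {v₀ : ℝ} (hv₀ : v₀ ∈ E γ) (hv : Tendsto v atTop (𝓝 v₀)) :
    Tendsto (fun t => rescale (law K (a t * v t + b t)) (α t) (β t)) atTop
      (𝓝 (law φs ⟨gev γ v₀, gev_pos hv₀⟩)) := by
  obtain ⟨s, hs, hsb⟩ := hdoa.exists_path ha hbs_cont hbs_mono hbs hv₀ hv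
  refine (h s ⟨gev γ v₀, gev_pos hv₀⟩ hs).congr' ?_
  filter_upwards [hsb] with t ht
  rw [standardize, ht]

theorem ConvergesTo.standardized (hdoa : InDomainOfAttraction P Y γ a b)
    (ha : ∀ t, 0 < t → 0 < a t)
    (hbs : Tendsto (fun t => (bs t - b t) / a t) atTop (𝓝 0))
    {φ : Kernel (E γ) EReal} [IsMarkovKernel φ]
    (h : ConvergesTo (fun t u => rescale (law K (a t * u + b t)) (α t) (β t)) (E γ) φ)
    {u : ℝ → ℝ} {u₀ : ℝ} (hu₀ : 0 < u₀) (hu : Tendsto u atTop (𝓝 u₀)) :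
    Tendsto (fun t => rescale (standardize K bs (t * u t)) (α t) (β t)) atTop
      (𝓝 (law φ ⟨gevInv γ u₀, gevInv_mem hu₀⟩)) := by
  refine (h _ ⟨gevInv γ u₀, gevInv_mem hu₀⟩ (hdoa.tendsto_normalized ha hbs hu₀ hu)).congr' ?_
  filter_upwards [eventually_gt_atTop 0] with t ht
  rw [standardize, mul_div_cancel₀ _ (ha t ht).ne', sub_add_cancel]

/-! ### Functional equations for the limits of the norming functions. -/

/-- `log ∘ C ∘ exp` is additive and continuous at 0, hence linear. -/
theorem exists_rpow_of_mul {C : ℝ → ℝ} (hpos : ∀ u, 0 < u → 0 < C u)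
    (hmul : ∀ u v, 0 < u → 0 < v → C (u * v) = C u * C v) (hcont : Tendsto C (𝓝 1) (𝓝 1)) :
    ∃ ρ : ℝ, ∀ u, 0 < u → C u = u ^ ρ := by
  let f : ℝ →+ ℝ := AddMonoidHom.mk' (fun x => Real.log (C (Real.exp x))) fun x y => by
    rw [Real.exp_add, hmul _ _ (Real.exp_pos x) (Real.exp_pos y),
      Real.log_mul (hpos _ (Real.exp_pos x)).ne' (hpos _ (Real.exp_pos y)).ne']
  have hf : Continuous f := by
    refine continuous_of_continuousAt_zero f ?_
    rw [ContinuousAt, map_zero]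
    have hexp : Tendsto Real.exp (𝓝 0) (𝓝 1) := by
      simpa using Real.continuous_exp.tendsto 0
    have hlog := (hcont.comp hexp).log one_ne_zero
    rw [Real.log_one] at hlog
    exact hlog
  refine ⟨f 1, fun u hu => ?_⟩
  have h := map_real_smul f hf (Real.log u) 1
  simp only [smul_eq_mul, mul_one] at h
  have h2 : f (Real.log u) = Real.log (C u) := by
    change Real.log (C (Real.exp (Real.log u))) = _
    rw [Real.exp_log hu]
  rw [Real.rpow_def_of_pos hu, ← h, h2, Real.exp_log (hpos u hu)]

/-- For `ρ = 0`, `D ∘ exp` is additive. Otherwise expanding `D (u * 2) = D (2 * u)` both ways gives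
`D u * (2^ρ - 1) = D 2 * (u^ρ - 1)`. -/
theorem exists_psi_of_cocycle {D : ℝ → ℝ} {ρ : ℝ}
    (hadd : ∀ u v, 0 < u → 0 < v → D (u * v) = D u + u ^ ρ * D v)
    (hcont : Tendsto D (𝓝 1) (𝓝 0)) :
    ∃ k : ℝ, ∀ u, 0 < u → D u = psi ρ k u := by
  by_cases hρ : ρ = 0
  · subst hρ
    let f : ℝ →+ ℝ := AddMonoidHom.mk' (fun x => D (Real.exp x)) fun x y => by
      rw [Real.exp_add, hadd _ _ (Real.exp_pos x) (Real.exp_pos y), Real.rpow_zero, one_mul]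
    have hf : Continuous f := by
      refine continuous_of_continuousAt_zero f ?_
      rw [ContinuousAt, map_zero]
      have hexp : Tendsto Real.exp (𝓝 0) (𝓝 1) := by
        simpa using Real.continuous_exp.tendsto 0
      exact hcont.comp hexp
    refine ⟨f 1, fun u hu => ?_⟩
    have h := map_real_smul f hf (Real.log u) 1
    simp only [smul_eq_mul, mul_one] at h
    have h2 : f (Real.log u) = D u := by
      change D (Real.exp (Real.log u)) = _
      rw [Real.exp_log hu]
    rw [psi, if_pos rfl, ← h2, h, mul_comm]
  · have h2 : (2 : ℝ) ^ ρ - 1 ≠ 0 := by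
      intro h
      have hlog := congrArg Real.log (sub_eq_zero.1 h)
      rw [Real.log_rpow two_pos, Real.log_one] at hlog
      exact (mul_ne_zero hρ (Real.log_pos one_lt_two).ne') hlog
    refine ⟨ρ * D 2 / (2 ^ ρ - 1), fun u hu => ?_⟩
    have h3 := hadd u 2 hu two_pos
    have h4 := hadd 2 u two_pos hu
    rw [mul_comm, h4] at h3
    rw [psi, if_neg hρ]
    field_simp
    linarith

/-! ### Extended regular variation of the norming functions. -/

section Types

variable {π : ℝ → ProbabilityMeasure EReal} {α β : ℝ → ℝ}
  {φ : Set.Ioi (0 : ℝ) → ProbabilityMeasure EReal}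

theorem rescale_change (hα : ∀ t, 0 < t → 0 < α t) (μ : ProbabilityMeasure EReal) {s t : ℝ}
    (hs : 0 < s) (ht : 0 < t) :
    rescale (rescale μ (α t) (β t)) (α s / α t) ((β s - β t) / α t) = rescale μ (α s) (β s) := by
  have h := hα t ht
  rw [rescale_rescale _ h (div_pos (hα s hs) h), mul_div_cancel₀ _ h.ne', mul_div_cancel₀ _ h.ne',
    add_sub_cancel]

variable (hα : ∀ t, 0 < t → 0 < α t)
  (h : ∀ (u : ℝ → ℝ) (u₀ : Set.Ioi (0 : ℝ)), Tendsto u atTop (𝓝 (u₀ : ℝ)) →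
    Tendsto (fun t => rescale (π (t * u t)) (α t) (β t)) atTop (𝓝 (φ u₀)))
  (hnd : NonDegenerate (φ ⟨1, Set.mem_Ioi.2 one_pos⟩ : Measure EReal))

include h in
theorem tendsto_rescale_self :
    Tendsto (fun s => rescale (π s) (α s) (β s)) atTop (𝓝 (φ ⟨1, Set.mem_Ioi.2 one_pos⟩)) := by
  simpa using h (fun _ => 1) ⟨1, Set.mem_Ioi.2 one_pos⟩ tendsto_const_nhds

include hα h hnd in
-- Normed at `t` or at `tu`, the law `π(tu)` tends to the same non-degenerate limit as `t → ∞` and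
-- `u → 1`. Joint convergence supplies both local bounds and continuity at 1.
theorem tendsto_norming_joint :
    Tendsto (fun p : ℝ × ℝ => α (p.1 * p.2) / α p.1) (atTop ×ˢ 𝓝 1) (𝓝 1) ∧
    Tendsto (fun p : ℝ × ℝ => (β (p.1 * p.2) - β p.1) / α p.1) (atTop ×ˢ 𝓝 1) (𝓝 0) := by
  have hpos : ∀ᶠ p : ℝ × ℝ in atTop ×ˢ 𝓝 1, 0 < p.1 ∧ 0 < p.1 * p.2 := by
    filter_upwards [(eventually_gt_atTop (0 : ℝ)).prod_mk (lt_mem_nhds (one_pos (α := ℝ)))]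
      with p hp using ⟨hp.1, mul_pos hp.1 hp.2⟩
  have hmul : Tendsto (fun p : ℝ × ℝ => p.1 * p.2) (atTop ×ˢ 𝓝 1) atTop :=
    tendsto_fst.atTop_mul_pos one_pos tendsto_snd
  refine tendsto_of_rescale_tendsto hnd (μ := fun p : ℝ × ℝ => rescale (π (p.1 * p.2)) (α p.1) (β p.1))
    (hpos.mono fun p hp => div_pos (hα _ hp.2) (hα _ hp.1)) ?_ ?_
  · exact tendsto_prod_of_forall_path (F := fun t u => rescale (π (t * u)) (α t) (β t))
      fun u hu => h u ⟨1, Set.mem_Ioi.2 one_pos⟩ hu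
  · refine ((tendsto_rescale_self h).comp hmul).congr' (hpos.mono fun p hp => ?_)
    exact (rescale_change hα _ hp.2 hp.1).symm

include hα h hnd in
/-- If the norming functions stay in a compact set along `t u`, they converge. -/
theorem exists_tendsto_norming_of_bounded {u : ℝ} (hu : 0 < u) {m M B : ℝ} (hm : 0 < m)
    (hbdd : ∀ᶠ t in atTop, α (t * u) / α t ∈ Set.Icc m M ∧
      (β (t * u) - β t) / α t ∈ Set.Icc (-B) B) :
    ∃ c d : ℝ, 0 < c ∧ Tendsto (fun t => α (t * u) / α t) atTop (𝓝 c) ∧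
      Tendsto (fun t => (β (t * u) - β t) / α t) atTop (𝓝 d) := by
  have hμ := h (fun _ => u) ⟨u, hu⟩ tendsto_const_nhds
  have htu : Tendsto (fun t : ℝ => t * u) atTop atTop := tendsto_id.atTop_mul_const hu
  have hν : Tendsto (fun t => rescale (rescale (π (t * u)) (α t) (β t)) (α (t * u) / α t)
      ((β (t * u) - β t) / α t)) atTop (𝓝 (φ ⟨1, Set.mem_Ioi.2 one_pos⟩)) := by
    refine ((tendsto_rescale_self h).comp htu).congr' ?_
    filter_upwards [eventually_gt_atTop 0] with t ht
    exact (rescale_change hα _ (mul_pos ht hu) ht).symm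
  -- One cluster value `(c, d)` suffices: it already forces `φ(u)`, rescaled by `(c, d)`, to be the
  -- limit at 1. The bound `m` keeps `c` positive.
  let U : Ultrafilter ℝ := Ultrafilter.of atTop
  have hU : (U : Filter ℝ) ≤ atTop := Ultrafilter.of_le atTop
  obtain ⟨⟨c, d⟩, hcd, hlim⟩ := (isCompact_Icc.prod isCompact_Icc).ultrafilter_le_nhds
    (U.map fun t => (α (t * u) / α t, (β (t * u) - β t) / α t))
    (le_principal_iff.2 (hU hbdd))
  have hc : 0 < c := hm.trans_le hcd.1.1
  have hlim : Tendsto (fun t => (α (t * u) / α t, (β (t * u) - β t) / α t)) U (𝓝 (c, d)) := hlim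
  have heq : rescale (φ ⟨u, hu⟩) c d = φ ⟨1, Set.mem_Ioi.2 one_pos⟩ :=
    tendsto_nhds_unique
      (tendsto_rescale (hμ.mono_left hU) hc hlim.fst_nhds hlim.snd_nhds) (hν.mono_left hU)
  -- After rescaling by the fixed `(c, d)`, both normings have the same non-degenerate limit, so
  -- convergence of types holds along the full filter.
  have hμ' := tendsto_rescale hμ hc (tendsto_const_nhds (x := c)) (tendsto_const_nhds (x := d))
  rw [heq] at hμ'
  have hpos : ∀ᶠ t in atTop, 0 < α (t * u) / α t := by
    filter_upwards [eventually_gt_atTop 0] with t ht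
    exact div_pos (hα _ (mul_pos ht hu)) (hα t ht)
  obtain ⟨h1, h2⟩ := tendsto_of_rescale_tendsto hnd
    (c := fun t => α (t * u) / α t / c) (d := fun t => ((β (t * u) - β t) / α t - d) / c)
    (hpos.mono fun t ht => div_pos ht hc) hμ' (hν.congr' (hpos.mono fun t ht => by
      beta_reduce
      rw [rescale_rescale _ hc (div_pos ht hc), mul_div_cancel₀ _ hc.ne', mul_div_cancel₀ _ hc.ne',
        add_sub_cancel]))
  refine ⟨c, d, hc, ?_, ?_⟩
  · simpa [div_mul_cancel₀ _ hc.ne'] using h1.mul_const c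
  · simpa [div_mul_cancel₀ _ hc.ne'] using (h2.mul_const c).add_const d

/-- The change of norming from `t` to `tuv` factors through `tu`, which also tends to infinity. -/
theorem tendsto_norming_mul (hα : ∀ t, 0 < t → 0 < α t) {u v c d c' d' : ℝ} (hu : 0 < u)
    (h1 : Tendsto (fun t => α (t * u) / α t) atTop (𝓝 c))
    (h2 : Tendsto (fun t => (β (t * u) - β t) / α t) atTop (𝓝 d))
    (h3 : Tendsto (fun t => α (t * v) / α t) atTop (𝓝 c'))
    (h4 : Tendsto (fun t => (β (t * v) - β t) / α t) atTop (𝓝 d')) :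
    Tendsto (fun t => α (t * (u * v)) / α t) atTop (𝓝 (c * c')) ∧
    Tendsto (fun t => (β (t * (u * v)) - β t) / α t) atTop (𝓝 (d + c * d')) := by
  have htu : Tendsto (fun t : ℝ => t * u) atTop atTop := tendsto_id.atTop_mul_const hu
  constructor
  · refine (h1.mul (h3.comp htu)).congr' ?_
    filter_upwards [eventually_gt_atTop 0] with t ht
    have := (hα t ht).ne'
    have := (hα _ (mul_pos ht hu)).ne'
    simp only [Function.comp, mul_assoc]
    field_simp
  · refine (h2.add (h1.mul (h4.comp htu))).congr' ?_
    filter_upwards [eventually_gt_atTop 0] with t ht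
    have := (hα t ht).ne'
    have := (hα _ (mul_pos ht hu)).ne'
    simp only [Function.comp, mul_assoc]
    field_simp
    ring

include hα h hnd in
-- Bounds are available only near 1, so the limits are obtained at a root `u^(1/n)` close to 1 and
-- propagated to its powers.
theorem exists_tendsto_norming {u : ℝ} (hu : 0 < u) :
    ∃ c d : ℝ, 0 < c ∧ Tendsto (fun t => α (t * u) / α t) atTop (𝓝 c) ∧
      Tendsto (fun t => (β (t * u) - β t) / α t) atTop (𝓝 d) := by
  obtain ⟨j1, j2⟩ := tendsto_norming_joint hα h hnd
  have hev : ∀ᶠ p : ℝ × ℝ in atTop ×ˢ 𝓝 1,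
      α (p.1 * p.2) / α p.1 ∈ Set.Icc (1 / 2 : ℝ) 2 ∧
        (β (p.1 * p.2) - β p.1) / α p.1 ∈ Set.Icc (-1 : ℝ) 1 :=
    (j1.eventually (Icc_mem_nhds (by norm_num) (by norm_num))).and
      (j2.eventually (Icc_mem_nhds (by norm_num) (by norm_num)))
  have hnear : ∀ᶠ v in 𝓝 (1 : ℝ), ∀ᶠ t in atTop,
      α (t * v) / α t ∈ Set.Icc (1 / 2 : ℝ) 2 ∧ (β (t * v) - β t) / α t ∈ Set.Icc (-1 : ℝ) 1 :=
    (eventually_swap_iff.1 hev).curry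
  have hroot : Tendsto (fun n : ℕ => u ^ ((n : ℝ)⁻¹)) atTop (𝓝 1) := by
    have h0 := (Real.continuousAt_const_rpow (b := 0) hu.ne').tendsto
    rw [Real.rpow_zero] at h0
    exact h0.comp (tendsto_inv_atTop_nhds_zero_nat (𝕜 := ℝ))
  obtain ⟨n, hn, hn0⟩ := ((hroot.eventually hnear).and (eventually_ne_atTop 0)).exists
  set v := u ^ ((n : ℝ)⁻¹) with hv
  have hvpos : 0 < v := Real.rpow_pos_of_pos hu _
  obtain ⟨c, d, hc, hc', hd'⟩ :=
    exists_tendsto_norming_of_bounded hα h hnd hvpos (by norm_num) hn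
  have hpow : ∀ m : ℕ, ∃ c d : ℝ, 0 < c ∧ Tendsto (fun t => α (t * v ^ m) / α t) atTop (𝓝 c) ∧
      Tendsto (fun t => (β (t * v ^ m) - β t) / α t) atTop (𝓝 d) := by
    intro m
    induction m with
    | zero =>
      refine ⟨1, 0, one_pos, ?_, by simp⟩
      refine tendsto_const_nhds.congr' ?_
      filter_upwards [eventually_gt_atTop 0] with t ht
      simp [div_self (hα t ht).ne']
    | succ m ih =>
      obtain ⟨c₁, d₁, hc₁, h1, h2⟩ := ih
      obtain ⟨h3, h4⟩ := tendsto_norming_mul hα (pow_pos hvpos m) h1 h2 hc' hd'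
      rw [pow_succ]
      exact ⟨_, _, mul_pos hc₁ hc, h3, h4⟩
  have := hpow n
  rwa [hv, Real.rpow_inv_natCast_pow hu.le hn0] at this

include hα h hnd in
theorem exists_erv :
    ∃ ρ k : ℝ, ERV α β ρ k ∧ ∀ u : Set.Ioi (0 : ℝ),
      (φ u : Measure EReal)
        = tailKernel ρ k (φ ⟨1, Set.mem_Ioi.2 one_pos⟩ : Measure EReal) u := by
  have hex : ∀ u : ℝ, ∃ p : ℝ × ℝ, 0 < u → 0 < p.1 ∧
      Tendsto (fun t => α (t * u) / α t) atTop (𝓝 p.1) ∧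
      Tendsto (fun t => (β (t * u) - β t) / α t) atTop (𝓝 p.2) := by
    intro u
    by_cases hu : 0 < u
    · obtain ⟨c, d, hcd⟩ := exists_tendsto_norming hα h hnd hu
      exact ⟨(c, d), fun _ => hcd⟩
    · exact ⟨0, fun h => (hu h).elim⟩
  choose L hL using hex
  obtain ⟨j1, j2⟩ := tendsto_norming_joint hα h hnd
  -- A joint limit together with limits in `t` at each fixed `u` gives the iterated limit, here
  -- continuity of the limits at 1.
  have hcont : ∀ (g : ℝ → ℝ → ℝ) (l : ℝ → ℝ) (x : ℝ),
      Tendsto (fun p : ℝ × ℝ => g p.1 p.2) (atTop ×ˢ 𝓝 1) (𝓝 x) →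
      (∀ u, 0 < u → Tendsto (fun t => g t u) atTop (𝓝 (l u))) → Tendsto l (𝓝 1) (𝓝 x) := by
    intro g l x hg hl
    refine Metric.tendsto_nhds.2 fun ε hε => ?_
    have hev := hg.eventually (Metric.closedBall_mem_nhds x (half_pos hε))
    have hev' := (eventually_swap_iff.1 hev).curry
    filter_upwards [hev', lt_mem_nhds (one_pos (α := ℝ))] with u hu hu0
    exact (Metric.isClosed_closedBall.mem_of_tendsto (hl u hu0) hu).trans_lt (half_lt_self hε)
  have hLmul : ∀ u v, 0 < u → 0 < v →
      (L (u * v)).1 = (L u).1 * (L v).1 ∧ (L (u * v)).2 = (L u).2 + (L u).1 * (L v).2 := by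
    intro u v hu hv
    obtain ⟨h1, h2⟩ := tendsto_norming_mul hα hu (hL u hu).2.1 (hL u hu).2.2 (hL v hv).2.1
      (hL v hv).2.2
    have h3 := hL (u * v) (mul_pos hu hv)
    exact ⟨tendsto_nhds_unique h3.2.1 h1, tendsto_nhds_unique h3.2.2 h2⟩
  obtain ⟨ρ, hρ⟩ := exists_rpow_of_mul (C := fun u => (L u).1) (fun u hu => (hL u hu).1)
    (fun u v hu hv => (hLmul u v hu hv).1)
    (hcont (fun t u => α (t * u) / α t) _ _ j1 fun u hu => (hL u hu).2.1)
  obtain ⟨k, hk⟩ := exists_psi_of_cocycle (D := fun u => (L u).2) (ρ := ρ)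
    (fun u v hu hv => by rw [← hρ u hu]; exact (hLmul u v hu hv).2)
    (hcont (fun t u => (β (t * u) - β t) / α t) _ _ j2 fun u hu => (hL u hu).2.2)
  have herv : ERV α β ρ k := by
    intro u hu
    rw [← hρ u hu, ← hk u hu]
    exact (hL u hu).2
  refine ⟨ρ, k, herv, fun ⟨u, hu⟩ => ?_⟩
  have hu : 0 < u := hu
  have hc : 0 < u ^ ρ := Real.rpow_pos_of_pos hu ρ
  have htu : Tendsto (fun t : ℝ => t * u) atTop atTop := tendsto_id.atTop_mul_const hu
  have h1 := tendsto_rescale (h (fun _ => u) ⟨u, hu⟩ tendsto_const_nhds) hc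
    (herv u hu).1 (herv u hu).2
  have h2 := (tendsto_rescale_self h).comp htu
  have heq : rescale (φ ⟨u, hu⟩) (u ^ ρ) (psi ρ k u) = φ ⟨1, Set.mem_Ioi.2 one_pos⟩ := by
    refine tendsto_nhds_unique h1 (h2.congr' ?_)
    filter_upwards [eventually_gt_atTop 0] with t ht
    exact (rescale_change hα _ (mul_pos ht hu) ht).symm
  rw [tailKernel, ← heq, map_affine_rescale _ hc]

end Types

end KernelCEV

end

/-! ### Assembly of the proposition. -/

theorem proposition5p2
    {Ω : Type*} [MeasurableSpace Ω] (P : Measure Ω) [IsProbabilityMeasure P]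
    (Y : Ω → ℝ) (hY : Measurable Y)
    (γ : ℝ) (a b : ℝ → ℝ) (ha : ∀ t, 0 < t → 0 < a t)
    (hdoa : KernelCEV.InDomainOfAttraction P Y γ a b)
    (bs : ℝ → ℝ) (hbs_cont : ContinuousOn bs (Set.Ioi 0)) (hbs_mono : StrictMonoOn bs (Set.Ioi 0))
    (hbs : Tendsto (fun t => (bs t - b t) / a t) atTop (𝓝 0))
    (K : Kernel ℝ EReal) [IsMarkovKernel K]
    (α β : ℝ → ℝ) (hα : ∀ t, 0 < t → 0 < α t) :
    ((∃ (φs : Kernel (Set.Ioi (0 : ℝ)) EReal) (_ : IsMarkovKernel φs),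
        KernelCEV.ConvergesTo
          (fun t u => KernelCEV.rescale (KernelCEV.standardize K bs (t * u)) (α t) (β t))
          (Set.Ioi 0) φs) ↔
      (∃ (φ : Kernel (KernelCEV.E γ) EReal) (_ : IsMarkovKernel φ),
        KernelCEV.ConvergesTo
          (fun t u => KernelCEV.rescale (KernelCEV.law K (a t * u + b t)) (α t) (β t))
          (KernelCEV.E γ) φ)) ∧
    (∀ (φs : Kernel (Set.Ioi (0 : ℝ)) EReal) [IsMarkovKernel φs]
      (φ : Kernel (KernelCEV.E γ) EReal) [IsMarkovKernel φ],
      KernelCEV.ConvergesTo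
        (fun t u => KernelCEV.rescale (KernelCEV.standardize K bs (t * u)) (α t) (β t))
        (Set.Ioi 0) φs →
      KernelCEV.ConvergesTo
        (fun t u => KernelCEV.rescale (KernelCEV.law K (a t * u + b t)) (α t) (β t))
        (KernelCEV.E γ) φ →
      φ ⟨0, KernelCEV.zero_mem_E γ⟩ = φs ⟨1, Set.mem_Ioi.2 one_pos⟩ ∧
      (KernelCEV.NonDegenerate (φs ⟨1, Set.mem_Ioi.2 one_pos⟩) →
        ∃ ρ k : ℝ, KernelCEV.ERV α β ρ k ∧
          (∀ u : Set.Ioi (0 : ℝ),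
            φs u = KernelCEV.tailKernel ρ k (φs ⟨1, Set.mem_Ioi.2 one_pos⟩) u) ∧
          (∀ u : KernelCEV.E γ,
            φ u = KernelCEV.tailKernel ρ k (φ ⟨0, KernelCEV.zero_mem_E γ⟩)
              (KernelCEV.gev γ u)))) := by
  
  refine ⟨⟨?_, ?_⟩, ?_⟩
  · rintro ⟨φs, hφs, h⟩
    have hm : Measurable (fun y : KernelCEV.E γ =>
        (⟨KernelCEV.gev γ y, KernelCEV.gev_pos y.2⟩ : Set.Ioi (0 : ℝ))) :=
      ((KernelCEV.measurable_gev γ).comp measurable_subtype_coe).subtype_mk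
    refine ⟨φs.comap _ hm, inferInstance, fun v v₀ hv => ?_⟩
    convert! h.of_standardized hdoa ha hbs_cont hbs_mono hbs v₀.2 hv using 2
  · rintro ⟨φ, hφ, h⟩
    have hm : Measurable (fun u : Set.Ioi (0 : ℝ) =>
        (⟨KernelCEV.gevInv γ u, KernelCEV.gevInv_mem u.2⟩ : KernelCEV.E γ)) :=
      ((KernelCEV.measurable_gevInv γ).comp measurable_subtype_coe).subtype_mk
    refine ⟨φ.comap _ hm, inferInstance, fun u u₀ hu => ?_⟩
    convert! h.standardized hdoa ha hbs u₀.2 hu using 2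
  · intro φs _ φ _ hs h
    -- Constant paths and uniqueness of weak limits identify the two kernels.
    have hrel : ∀ v : KernelCEV.E γ, φ v = φs ⟨KernelCEV.gev γ v, KernelCEV.gev_pos v.2⟩ :=
      fun v => congrArg (fun μ : ProbabilityMeasure EReal => (μ : Measure EReal))
        (tendsto_nhds_unique (h (fun _ => v) v tendsto_const_nhds)
          (hs.of_standardized hdoa ha hbs_cont hbs_mono hbs v.2 tendsto_const_nhds))
    have hzero : φ ⟨0, KernelCEV.zero_mem_E γ⟩ = φs ⟨1, Set.mem_Ioi.2 one_pos⟩ := by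
      rw [hrel]
      congr 1
      exact Subtype.ext (KernelCEV.gev_zero γ)
    refine ⟨hzero, fun hnd => ?_⟩
    obtain ⟨ρ, k, herv, hker⟩ := KernelCEV.exists_erv (π := KernelCEV.standardize K bs)
      (φ := KernelCEV.law φs) hα hs hnd
    exact ⟨ρ, k, herv, hker, fun v => by rw [hzero, hrel]; exact hker _⟩
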